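/- Let $d\in\mathbb N$ and let $\rho$ be a state (a positive semidefinite matrix of trace one) on $\mathbb C^d\otimes\mathbb C^d$. For a unit vector $\psi$ with reduced state $\rho_A(\psi)=\mathrm{Tr}_B|\psi\rangle\langle\psi|$ put $G(\psi)=d\,(\det\rho_A(\psi))^{1/d}$, and let $G(\rho)=\inf\sum_i p_iG(\psi_i)$, the infimum being over all finite decompositions $\rho=\sum_i p_i|\psi_i\rangle\langle\psi_i|$ into unit vectors with probabilities $p_i$ (the $G$-concurrence). The Schmidt number of $\rho$ is the least $k$ such that $\rho$ is a finite mixture of pure states of Schmidt rank at most $k$. Let $V$ be the swap operator, $V(\phi\otimes\chi)=\chi\otimes\phi$. The state $\rho$ can be swapped by LOCC (respectively by a separable operation) if $\Lambda(\rho)=V\rho V$ for some operation $\Lambda$ on $\mathbb C^d\otimes\mathbb C^d$ that is performed by a finite protocol of local operations (measurements and channels, with local ancillas) and classical communication (respectively for some $\Lambda(X)=\sum_i (A_i\otimes B_i)X(A_i\otimes B_i)^\dagger$ with a finite sum and $\sum_i (A_i\otimes B_i)^\dagger(A_i\otimes B_i)=I$); it can be swapped by a product unitary if $(U_A\otimes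 U_B)\rho(U_A\otimes U_B)^\dagger=V\rho V$ for some unitaries $U_A,U_B$ on $\mathbb C^d$. Then: 1. $G(\rho)>0$ if and only if $\rho$ has Schmidt number $d$. 2. If $G(\rho)>0$ and $\rho$ can be swapped by LOCC, or by a separable operation, then $\rho$ can be swapped by a product unitary. 3. If $G(\rho)>0$ and the two marginals $\mathrm{Tr}_B\rho$ and $\mathrm{Tr}_A\rho$ have different spectra (counted with multiplicity), then $\rho$ can be swapped neither by LOCC nor by a separable operation. 4. If $d=2$, then $\rho$ is entangled (not a finite convex combination of product states) if and only if $G(\rho)>0$; and if $\rho$ is entangled, then it can be swapped by LOCC if and only if it can be swapped by a product unitary, and likewise for separable operations in place of LOCC. -/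

import Mathlib

open scoped ComplexOrder Matrix Kronecker

noncomputable section

namespace Bipartite

/-- Operators from `ℂ^a ⊗ ℂ^b` to itself, as matrices in the product basis. -/
abbrev Op (a b : ℕ) : Type := Matrix (Fin a × Fin b) (Fin a × Fin b) ℂ

/-- Density matrices: positive semidefinite of trace one. -/
def IsState {ι : Type} [Fintype ι] (ρ : Matrix ι ι ℂ) : Prop :=
  ρ.PosSemidef ∧ ρ.trace = 1

/-- Reduced operator on the first factor, `Tr_B X`. -/
def marginalA {a b : ℕ} (X : Op a b) : Matrix (Fin a) (Fin a) ℂ :=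
  Matrix.of fun i k => ∑ j, X (i, j) (k, j)

/-- Reduced operator on the second factor, `Tr_A X`. -/
def marginalB {a b : ℕ} (X : Op a b) : Matrix (Fin b) (Fin b) ℂ :=
  Matrix.of fun j l => ∑ i, X (i, j) (i, l)

/-- The rank-one operator `|ψ⟩⟨ψ|`. -/
def proj {a b : ℕ} (ψ : Fin a × Fin b → ℂ) : Op a b :=
  Matrix.vecMulVec ψ (star ψ)

/-- `ρ = ∑ i, p i |ψ i⟩⟨ψ i|` with probabilities `p i` and unit vectors `ψ i`. -/
def IsPureDecomposition {a b r : ℕ} (ρ : Op a b) (p : Fin r → ℝ)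
    (ψ : Fin r → Fin a × Fin b → ℂ) : Prop :=
  (∀ i, 0 ≤ p i) ∧ ∑ i, p i = 1 ∧ (∀ i, star (ψ i) ⬝ᵥ ψ i = 1) ∧
    ρ = ∑ i, (p i : ℂ) • proj (ψ i)

/-- `G`-concurrence of a pure state, `G(ψ) = d (det ρ_A)^(1/d)`;
the determinant is a nonnegative real number. -/
def pureG {d : ℕ} (ψ : Fin d × Fin d → ℂ) : ℝ :=
  (d : ℝ) * (marginalA (proj ψ)).det.re ^ ((1 : ℝ) / (d : ℝ))

/-- `G`-concurrence of a mixed state: the convex roof of `pureG`. -/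
def gConcurrence {d : ℕ} (ρ : Op d d) : ℝ :=
  sInf {x : ℝ | ∃ (r : ℕ) (p : Fin r → ℝ) (ψ : Fin r → Fin d × Fin d → ℂ),
    IsPureDecomposition ρ p ψ ∧ x = ∑ i, p i * pureG (ψ i)}

/-- Schmidt rank of a vector: the rank of its coefficient matrix. -/
def schmidtRank {a b : ℕ} (ψ : Fin a × Fin b → ℂ) : ℕ :=
  (Matrix.of fun i j => ψ (i, j)).rank

/-- Schmidt number of a mixed state: the least `k` such that the state is a mixture of
pure states of Schmidt rank at most `k`. -/
def schmidtNumber {a b : ℕ} (ρ : Op a b) : ℕ :=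
  sInf {k : ℕ | ∃ (r : ℕ) (p : Fin r → ℝ) (ψ : Fin r → Fin a × Fin b → ℂ),
    IsPureDecomposition ρ p ψ ∧ ∀ i, schmidtRank (ψ i) ≤ k}

/-- Separable states: finite convex combinations of product states. -/
def IsSeparableState {a b : ℕ} (ρ : Op a b) : Prop :=
  ∃ (r : ℕ) (p : Fin r → ℝ) (α : Fin r → Matrix (Fin a) (Fin a) ℂ)
    (β : Fin r → Matrix (Fin b) (Fin b) ℂ),
    (∀ i, 0 ≤ p i) ∧ ∑ i, p i = 1 ∧ (∀ i, IsState (α i)) ∧ (∀ i, IsState (β i)) ∧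
    ρ = ∑ i, (p i : ℂ) • (α i ⊗ₖ β i)

/-- Entangled states. -/
def IsEntangled {a b : ℕ} (ρ : Op a b) : Prop :=
  IsState ρ ∧ ¬ IsSeparableState ρ

/-- The swap operator `V`, with `V (φ ⊗ χ) = χ ⊗ φ`. -/
def swapOp (d : ℕ) : Op d d :=
  Matrix.of fun x y => if x.1 = y.2 ∧ x.2 = y.1 then 1 else 0

/-- The swapped operator `V ρ V†` (here `V† = V`). -/
def swapped {d : ℕ} (ρ : Op d d) : Op d d :=
  swapOp d * ρ * (swapOp d)ᴴ

/-- Trace-preserving separable operations: those with a finite Kraus representation by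
product operators `A i ⊗ B i`. -/
def IsSeparableOperation {a b m n : ℕ} (Λ : Op a b → Op m n) : Prop :=
  ∃ (r : ℕ) (A : Fin r → Matrix (Fin m) (Fin a) ℂ) (B : Fin r → Matrix (Fin n) (Fin b) ℂ),
    ∑ i, (A i ⊗ₖ B i)ᴴ * (A i ⊗ₖ B i) = 1 ∧
    ∀ X, Λ X = ∑ i, (A i ⊗ₖ B i) * X * (A i ⊗ₖ B i)ᴴ

/-- LOCC operations with output space `ℂ^m ⊗ ℂ^n` and input space `ℂ^a ⊗ ℂ^b`: the operations
performed by a finite protocol. The protocol either stops, or one party makes a local measurement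
with Kraus operators `K i` and announces the outcome `i`, after which both parties go on with a
protocol that may depend on `i`. The dimension of the measured system may change, and may depend
on the outcome, so adding and discarding local ancillas, local unitaries and local channels are
measurements of this kind (an outcome is ignored by going on in the same way for all its values). -/
inductive IsLOCC (m n : ℕ) : (a b : ℕ) → (Op a b → Op m n) → Prop
  | stop_here : IsLOCC m n m n (fun X => X)
  | alice {a b r : ℕ} (c : Fin r → ℕ) (K : (i : Fin r) → Matrix (Fin (c i)) (Fin a) ℂ)
      (hK : ∑ i, (K i)ᴴ * K i = 1)
      (Λ : (i : Fin r) → Op (c i) b → Op m n) (hΛ : ∀ i, IsLOCC m n (c i) b (Λ i)) :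
      IsLOCC m n a b (fun X => ∑ i, Λ i
        ((K i ⊗ₖ (1 : Matrix (Fin b) (Fin b) ℂ)) * X *
          (K i ⊗ₖ (1 : Matrix (Fin b) (Fin b) ℂ))ᴴ))
  | bob {a b r : ℕ} (c : Fin r → ℕ) (K : (i : Fin r) → Matrix (Fin (c i)) (Fin b) ℂ)
      (hK : ∑ i, (K i)ᴴ * K i = 1)
      (Λ : (i : Fin r) → Op a (c i) → Op m n) (hΛ : ∀ i, IsLOCC m n a (c i) (Λ i)) :
      IsLOCC m n a b (fun X => ∑ i, Λ i
        (((1 : Matrix (Fin a) (Fin a) ℂ) ⊗ₖ K i) * X *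
          ((1 : Matrix (Fin a) (Fin a) ℂ) ⊗ₖ K i)ᴴ))

/-- `ρ` can be swapped by a trace-preserving separable operation. -/
def SepSwappable {d : ℕ} (ρ : Op d d) : Prop :=
  ∃ Λ : Op d d → Op d d, IsSeparableOperation Λ ∧ Λ ρ = swapped ρ

/-- `ρ` can be swapped by LOCC. -/
def LOCCSwappable {d : ℕ} (ρ : Op d d) : Prop :=
  ∃ Λ : Op d d → Op d d, IsLOCC d d d d Λ ∧ Λ ρ = swapped ρ

/-- `ρ` can be swapped by a product unitary `U_A ⊗ U_B`. -/
def LocalUnitarySwappable {d : ℕ} (ρ : Op d d) : Prop :=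
  ∃ UA ∈ Matrix.unitaryGroup (Fin d) ℂ, ∃ UB ∈ Matrix.unitaryGroup (Fin d) ℂ,
    (UA ⊗ₖ UB) * ρ * (UA ⊗ₖ UB)ᴴ = swapped ρ

/-- The spectrum of a matrix, eigenvalues counted with (algebraic) multiplicity. -/
def spec {d : ℕ} (X : Matrix (Fin d) (Fin d) ℂ) : Multiset ℂ := X.charpoly.roots

end Bipartite

end

open Bipartite

/-!
The determinant of the coefficient matrix turns the `G`-concurrence into a multiplicative
quantity: the coefficient matrix of `(A ⊗ B) ψ` is `A M Bᵀ`, so `G((A ⊗ B) ψ)` is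
`|det A det B| ^ (2 / d) * G(ψ)` (`pureG_kronecker_mulVec`). As `pureG` is homogeneous of degree two,
mixed states may be decomposed into unnormalised vectors `φ k` with `ρ = ∑ k, |φ k⟩⟨φ k|`.

*Schmidt number.* Such decompositions of a fixed length form a compact set, and by Carathéodory's
theorem a fixed length suffices, so the convex roof is attained (`exists_optimal_decomposition`).
Hence `G(ρ) = 0` exactly when `ρ` is a mixture of pure states with singular coefficient matrices,
that is, of Schmidt rank less than `d`. For `d = 2` these are product vectors, so that `G(ρ) = 0`
characterises separability.

*Swapping.* LOCC operations are separable (`IsLOCC.isSeparableOperation`), so let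
`V ρ V = ∑ i, (A i ⊗ B i) ρ (A i ⊗ B i)†`. The swap transposes coefficient matrices and preserves
`G`, so if `G(ρ) > 0` then the factors `g i = |det (A i) det (B i)| ^ (2 / d)` satisfy `1 ≤ ∑ i, g i`.
By the inequality of arithmetic and geometric means for the eigenvalues of
`P i = (A i ⊗ B i)† (A i ⊗ B i)`, each `g i` is at most `t i = tr (P i) / d²`, and `∑ i, t i = 1` because
the operation preserves the trace. Equality must therefore hold for every `i`, which makes `P i` equal
to `t i • 1` (`normSq_det_rpow_le`): the operation is a mixture of product unitaries. As `V ρ V` has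
the same Hilbert–Schmidt norm as `ρ`, the equality case of the triangle inequality
(`eq_smul_sum_of_trace_le`) shows that each of these product unitaries with `t i > 0` already swaps `ρ`.
In particular the two marginals are then unitarily equivalent.
-/

open scoped ComplexOrder Matrix Kronecker

namespace Bipartite

/-! ### The `G`-concurrence of unnormalised vectors -/

/-- The `d × d` coefficient matrix of a vector of `ℂ^d ⊗ ℂ^d`. -/
def coeffMatrix {d : ℕ} (ψ : Fin d × Fin d → ℂ) : Matrix (Fin d) (Fin d) ℂ :=
  Matrix.of fun i j => ψ (i, j)

lemma pureG_eq {d : ℕ} (ψ : Fin d × Fin d → ℂ) :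
    pureG ψ = d * Complex.normSq (coeffMatrix ψ).det ^ ((1 : ℝ) / d) := by
  have h : marginalA (proj ψ) = coeffMatrix ψ * (coeffMatrix ψ)ᴴ := by
    ext i k
    simp [marginalA, proj, coeffMatrix, Matrix.mul_apply, Matrix.vecMulVec_apply]
  rw [pureG, h, Matrix.det_mul, Matrix.det_conjTranspose, Complex.star_def, Complex.mul_conj,
    Complex.ofReal_re]

lemma pureG_nonneg {d : ℕ} (ψ : Fin d × Fin d → ℂ) : 0 ≤ pureG ψ := by
  rw [pureG_eq]
  exact mul_nonneg d.cast_nonneg (Real.rpow_nonneg (Complex.normSq_nonneg _) _)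

lemma pureG_eq_zero_iff {d : ℕ} (hd : d ≠ 0) (ψ : Fin d × Fin d → ℂ) :
    pureG ψ = 0 ↔ (coeffMatrix ψ).det = 0 := by
  rw [pureG_eq, mul_eq_zero, Real.rpow_eq_zero (Complex.normSq_nonneg _) (by simp [hd]),
    Complex.normSq_eq_zero]
  simp [hd]

lemma continuous_pureG {d : ℕ} : Continuous (pureG (d := d)) := by
  simp_rw [funext pureG_eq]
  refine continuous_const.mul (Continuous.rpow_const ?_ fun _ => Or.inr (by positivity))
  refine Complex.continuous_normSq.comp (Continuous.matrix_det ?_)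
  exact continuous_pi fun i => continuous_pi fun j => continuous_apply (i, j)

lemma coeffMatrix_kronecker_mulVec {d : ℕ} (A B : Matrix (Fin d) (Fin d) ℂ)
    (ψ : Fin d × Fin d → ℂ) :
    coeffMatrix ((A ⊗ₖ B) *ᵥ ψ) = A * coeffMatrix ψ * Bᵀ := by
  ext i j
  simp only [coeffMatrix, Matrix.of_apply, Matrix.mulVec, dotProduct, Matrix.kroneckerMap_apply,
    Fintype.sum_prod_type, Matrix.mul_apply, Matrix.transpose_apply, Finset.sum_mul]
  rw [Finset.sum_comm]
  exact Finset.sum_congr rfl fun l _ => Finset.sum_congr rfl fun k _ => by ring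

/-- The `G`-concurrence is multiplicative under product operators: the determinants of the two
factors come out. -/
lemma pureG_kronecker_mulVec {d : ℕ} (A B : Matrix (Fin d) (Fin d) ℂ) (ψ : Fin d × Fin d → ℂ) :
    pureG ((A ⊗ₖ B) *ᵥ ψ) = Complex.normSq (A.det * B.det) ^ ((1 : ℝ) / d) * pureG ψ := by
  rw [pureG_eq, pureG_eq, coeffMatrix_kronecker_mulVec, Matrix.det_mul, Matrix.det_mul,
    Matrix.det_transpose, mul_right_comm, Complex.normSq_mul _ (coeffMatrix ψ).det,
    Real.mul_rpow (Complex.normSq_nonneg _) (Complex.normSq_nonneg _)]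
  ring

lemma pureG_smul {d : ℕ} (hd : d ≠ 0) (c : ℂ) (ψ : Fin d × Fin d → ℂ) :
    pureG (c • ψ) = Complex.normSq c * pureG ψ := by
  have h : coeffMatrix (c • ψ) = c • coeffMatrix ψ := rfl
  rw [pureG_eq, pureG_eq, h, Matrix.det_smul, Complex.normSq_mul, map_pow, Fintype.card_fin,
    Real.mul_rpow (by positivity [Complex.normSq_nonneg c]) (Complex.normSq_nonneg _), one_div,
    Real.pow_rpow_inv_natCast (Complex.normSq_nonneg _) hd]
  ring

lemma pureG_zero {d : ℕ} (hd : d ≠ 0) : pureG (0 : Fin d × Fin d → ℂ) = 0 := by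
  simpa using pureG_smul hd 0 0

lemma mul_proj_mul_conjTranspose {a b m n : ℕ}
    (C : Matrix (Fin m × Fin n) (Fin a × Fin b) ℂ) (ψ : Fin a × Fin b → ℂ) :
    C * proj ψ * Cᴴ = proj (C *ᵥ ψ) := by
  rw [proj, proj, Matrix.mul_vecMulVec, Matrix.vecMulVec_mul, Matrix.star_mulVec]

lemma proj_smul {a b : ℕ} (c : ℂ) (ψ : Fin a × Fin b → ℂ) :
    proj (c • ψ) = (Complex.normSq c : ℂ) • proj ψ := by
  ext x y
  simp only [proj, Matrix.vecMulVec_apply, Matrix.smul_apply, Pi.smul_apply, Pi.star_apply,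
    smul_eq_mul, star_mul', Complex.star_def, ← Complex.mul_conj]
  ring

lemma proj_zero {a b : ℕ} : proj (0 : Fin a × Fin b → ℂ) = 0 := by
  simp [proj]

lemma trace_proj {a b : ℕ} (ψ : Fin a × Fin b → ℂ) :
    (proj ψ).trace = ((∑ x, Complex.normSq (ψ x) : ℝ) : ℂ) := by
  simp [proj, Matrix.trace, Matrix.vecMulVec_apply, Complex.mul_conj]

lemma star_dotProduct_self_eq {ι : Type*} [Fintype ι] (ψ : ι → ℂ) :
    star ψ ⬝ᵥ ψ = ((∑ x, Complex.normSq (ψ x) : ℝ) : ℂ) := by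
  simp [dotProduct, Complex.normSq_eq_conj_mul_self]

/-- A positive semidefinite matrix is a sum of unnormalised rank-one projections. -/
lemma exists_eq_sum_vecMulVec {ι : Type*} [Fintype ι] [DecidableEq ι] {P : Matrix ι ι ℂ}
    (hP : P.PosSemidef) : ∃ u : ι → ι → ℂ, P = ∑ k, Matrix.vecMulVec (u k) (star (u k)) := by
  open scoped MatrixOrder in
  obtain ⟨B, rfl⟩ := CStarAlgebra.nonneg_iff_eq_star_mul_self.mp hP.nonneg
  refine ⟨fun k => star (B k), ?_⟩
  ext i j
  simp [Matrix.star_eq_conjTranspose, Matrix.mul_apply, Matrix.sum_apply, Matrix.vecMulVec_apply]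

/-- Normalisation: a decomposition of a trace-one operator into unnormalised rank-one terms
becomes a pure-state decomposition with positive weights, in which every state is a multiple of
one of the given vectors. The vanishing terms are dropped. -/
lemma exists_isPureDecomposition {a b : ℕ} {κ : Type*} [Fintype κ] {ρ : Op a b}
    (hρ : ρ.trace = 1) (φ : κ → Fin a × Fin b → ℂ) (h : ρ = ∑ k, proj (φ k)) :
    ∃ (r : ℕ) (p : Fin r → ℝ) (ψ : Fin r → Fin a × Fin b → ℂ) (σ : Fin r → κ),
      IsPureDecomposition ρ p ψ ∧ (∀ i, ∃ c : ℂ, ψ i = c • φ (σ i)) ∧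
      ∀ f : (Fin a × Fin b → ℂ) → ℝ, (∀ (c : ℂ) ψ, f (c • ψ) = Complex.normSq c * f ψ) →
        ∑ i, p i * f (ψ i) = ∑ k, f (φ k) := by
  classical
  set N : κ → ℝ := fun k => ∑ x, Complex.normSq (φ k x) with hN
  have hN0 : ∀ k, 0 ≤ N k := fun k => Finset.sum_nonneg fun x _ => Complex.normSq_nonneg _
  have hNz : ∀ k, ¬ 0 < N k → φ k = 0 := by
    intro k hk
    have h0 : N k = 0 := le_antisymm (not_lt.mp hk) (hN0 k)
    rw [hN, Finset.sum_eq_zero_iff_of_nonneg fun x _ => Complex.normSq_nonneg _] at h0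
    funext x
    exact Complex.normSq_eq_zero.mp (h0 x (Finset.mem_univ x))
  let e := Fintype.equivFin {k // 0 < N k}
  -- a sum over the positive-norm vectors is the full sum
  have key : ∀ {M : Type} [AddCommMonoid M] (F : κ → M), (∀ k, φ k = 0 → F k = 0) →
      ∑ i, F (e.symm i).1 = ∑ k, F k := by
    intro M _ F hF
    have hc : ∑ i : {k // ¬ 0 < N k}, F i.1 = 0 :=
      Finset.sum_eq_zero fun k _ => hF k.1 (hNz k.1 k.2)
    rw [e.symm.sum_comp fun k => F k.1, ← Fintype.sum_subtype_add_sum_subtype (fun k => 0 < N k) F,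
      hc, add_zero]
  -- the factor which normalises the `i`-th surviving vector
  let c : Fin (Fintype.card {k // 0 < N k}) → ℂ := fun i => ((√(N (e.symm i).1))⁻¹ : ℝ)
  have hNc : ∀ i, N (e.symm i).1 * Complex.normSq (c i) = 1 := by
    intro i
    have hpos := (e.symm i).2
    rw [Complex.normSq_ofReal, ← mul_inv, Real.mul_self_sqrt hpos.le, mul_inv_cancel₀ hpos.ne']
  refine ⟨_, fun i => N (e.symm i).1, fun i => c i • φ (e.symm i).1, fun i => (e.symm i).1,
    ⟨fun i => hN0 _, ?_, fun i => ?_, ?_⟩, fun i => ⟨c i, rfl⟩, fun f hf => ?_⟩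
  · rw [key N fun k hk => by simp [hN, hk]]
    have := congrArg Matrix.trace h
    simp only [hρ, Matrix.trace_sum, trace_proj] at this
    exact_mod_cast this.symm
  · rw [star_dotProduct_self_eq, ← Complex.ofReal_one, ← hNc i]
    congr 1
    simp only [hN, Pi.smul_apply, smul_eq_mul, Complex.normSq_mul, ← Finset.mul_sum]
    ring
  · rw [h, ← key (fun k => proj (φ k)) fun k hk => by simp [hk, proj_zero]]
    refine Finset.sum_congr rfl fun i _ => ?_
    rw [proj_smul, smul_smul, ← Complex.ofReal_mul, hNc, Complex.ofReal_one, one_smul]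
  · rw [← key (fun k => f (φ k)) fun k hk => by simpa [hk] using hf 0 0]
    refine Finset.sum_congr rfl fun i _ => ?_
    rw [hf, ← mul_assoc, hNc, one_mul]

/-! ### Attainment of the convex roof -/

lemma bddBelow_decomposition_values {d : ℕ} (ρ : Op d d) :
    BddBelow {x : ℝ | ∃ (r : ℕ) (p : Fin r → ℝ) (ψ : Fin r → Fin d × Fin d → ℂ),
      IsPureDecomposition ρ p ψ ∧ x = ∑ i, p i * pureG (ψ i)} := by
  refine ⟨0, ?_⟩
  rintro _ ⟨r, p, ψ, h, rfl⟩
  exact Finset.sum_nonneg fun i _ => mul_nonneg (h.1 i) (pureG_nonneg _)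

lemma gConcurrence_nonneg {d : ℕ} (ρ : Op d d) : 0 ≤ gConcurrence ρ := by
  refine Real.sInf_nonneg ?_
  rintro _ ⟨r, p, ψ, h, rfl⟩
  exact Finset.sum_nonneg fun i _ => mul_nonneg (h.1 i) (pureG_nonneg _)

/-- Since `pureG` is homogeneous, unnormalised decompositions give upper bounds as well. -/
lemma gConcurrence_le_sum {d : ℕ} (hd : d ≠ 0) {κ : Type*} [Fintype κ] {ρ : Op d d}
    (hρ : ρ.trace = 1) (φ : κ → Fin d × Fin d → ℂ) (h : ρ = ∑ k, proj (φ k)) :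
    gConcurrence ρ ≤ ∑ k, pureG (φ k) := by
  obtain ⟨r, p, ψ, σ, hp, -, hf⟩ := exists_isPureDecomposition hρ φ h
  exact csInf_le (bddBelow_decomposition_values ρ)
    ⟨r, p, ψ, hp, (hf pureG (pureG_smul hd)).symm⟩

lemma exists_unnormalised_decomposition {a b : ℕ} {ρ : Op a b} (hρ : ρ.PosSemidef) :
    ∃ φ : Fin a × Fin b → Fin a × Fin b → ℂ, ρ = ∑ k, proj (φ k) :=
  exists_eq_sum_vecMulVec hρ

/-- Carathéodory bound: the number of terms of an unnormalised decomposition can be taken to be a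
fixed `N`, without changing the average `G`-concurrence. The decomposition is a convex combination
of points `(|ψ⟩⟨ψ|, G(ψ))` of a real space of dimension less than `N`; after Carathéodory's theorem
the missing terms are filled up by zero vectors. -/
lemma exists_fixed_length_decomposition {d : ℕ} (hd : d ≠ 0) {ρ : Op d d} {r : ℕ} {p : Fin r → ℝ}
    {ψ : Fin r → Fin d × Fin d → ℂ} (h : IsPureDecomposition ρ p ψ) :
    ∃ φ : Fin (Module.finrank ℝ (Op d d × ℝ) + 1) → Fin d × Fin d → ℂ,
      ρ = ∑ k, proj (φ k) ∧ ∑ i, p i * pureG (ψ i) = ∑ k, pureG (φ k) := by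
  let S : Set (Op d d × ℝ) := Set.range fun ψ => (proj ψ, pureG ψ)
  have hmem : (ρ, ∑ i, p i * pureG (ψ i)) ∈ convexHull ℝ S := by
    refine mem_convexHull_of_exists_fintype p (fun i => (proj (ψ i), pureG (ψ i))) h.1 h.2.1
      (fun i => ⟨ψ i, rfl⟩) ?_
    rw [Prod.ext_iff, Prod.fst_sum, Prod.snd_sum]
    refine ⟨?_, by simp⟩
    rw [h.2.2.2]
    exact Finset.sum_congr rfl fun i _ => by simp [Complex.coe_smul]
  obtain ⟨ι, _, z, w, hz, hind, hw, -, hsum⟩ := eq_pos_convex_span_of_mem_convexHull hmem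
  have hcard : Fintype.card ι ≤ Module.finrank ℝ (Op d d × ℝ) + 1 :=
    hind.card_le_finrank_succ.trans (Nat.succ_le_succ (Submodule.finrank_le _))
  choose η hη using fun i => hz ⟨i, rfl⟩
  have hnorm : ∀ i, Complex.normSq ((√(w i) : ℝ) : ℂ) = w i := fun i => by
    rw [Complex.normSq_ofReal, Real.mul_self_sqrt (hw i).le]
  have h1 : ρ = ∑ i, proj (((√(w i) : ℝ) : ℂ) • η i) := by
    refine (congrArg Prod.fst hsum).symm.trans ?_
    rw [Prod.fst_sum]
    refine Finset.sum_congr rfl fun i _ => ?_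
    rw [proj_smul, hnorm, ← hη i, Complex.coe_smul]
    rfl
  have h2 : ∑ i, p i * pureG (ψ i) = ∑ i, pureG (((√(w i) : ℝ) : ℂ) • η i) := by
    refine (congrArg Prod.snd hsum).symm.trans ?_
    rw [Prod.snd_sum]
    refine Finset.sum_congr rfl fun i _ => ?_
    rw [pureG_smul hd, hnorm, ← hη i]
    rfl
  generalize Module.finrank ℝ (Op d d × ℝ) + 1 = N at hcard ⊢
  obtain ⟨m, rfl⟩ := Nat.exists_eq_add_of_le hcard
  let e := Fintype.equivFin ι
  refine ⟨Fin.append (fun i => ((√(w (e.symm i)) : ℝ) : ℂ) • η (e.symm i)) fun _ => 0, ?_, ?_⟩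
  · rw [Fin.sum_univ_add]
    simp only [Fin.append_left, Fin.append_right, proj_zero, Finset.sum_const_zero, add_zero]
    rw [h1, e.symm.sum_comp fun i => proj (((√(w i) : ℝ) : ℂ) • η i)]
  · rw [Fin.sum_univ_add]
    simp only [Fin.append_left, Fin.append_right, pureG_zero hd, Finset.sum_const_zero, add_zero]
    rw [h2, e.symm.sum_comp fun i => pureG (((√(w i) : ℝ) : ℂ) • η i)]

/-- Decompositions of a fixed length into unnormalised vectors form a compact set: the norms of
the vectors are bounded because the trace is fixed. -/
lemma isCompact_decompositions {a b : ℕ} (ρ : Op a b) (N : ℕ) :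
    IsCompact {φ : Fin N → Fin a × Fin b → ℂ | ρ = ∑ k, proj (φ k)} := by
  have hcont : Continuous fun φ : Fin N → Fin a × Fin b → ℂ => ∑ k, proj (φ k) := by
    refine continuous_finsetSum _ fun k _ => ?_
    unfold proj
    exact (continuous_apply k).matrix_vecMulVec (continuous_apply k).star
  refine Metric.isCompact_of_isClosed_isBounded (isClosed_eq continuous_const hcont) ?_
  refine (Metric.isBounded_closedBall (x := 0) (r := √(ρ.trace.re))).subset fun φ hφ => ?_
  rw [mem_closedBall_zero_iff, pi_norm_le_iff_of_nonneg (Real.sqrt_nonneg _)]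
  intro k
  rw [pi_norm_le_iff_of_nonneg (Real.sqrt_nonneg _)]
  intro x
  have htr : ρ.trace.re = ∑ k, ∑ x, Complex.normSq (φ k x) := by
    have hφ' : ρ = ∑ k, proj (φ k) := hφ
    rw [hφ', Matrix.trace_sum]
    simp_rw [trace_proj]
    rw [← Complex.ofReal_sum, Complex.ofReal_re]
  refine Real.le_sqrt_of_sq_le ?_
  rw [← Complex.normSq_eq_norm_sq, htr]
  exact (Finset.single_le_sum (f := fun x => Complex.normSq (φ k x))
      (fun y _ => Complex.normSq_nonneg _) (Finset.mem_univ x)).trans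
    (Finset.single_le_sum (f := fun k => ∑ x, Complex.normSq (φ k x))
      (fun j _ => Finset.sum_nonneg fun y _ => Complex.normSq_nonneg _) (Finset.mem_univ k))

lemma dimension_ne_zero {d : ℕ} {ρ : Op d d} (hρ : ρ.trace = 1) : d ≠ 0 := by
  rintro rfl
  simp [Matrix.trace] at hρ

/-- The infimum in the convex roof is attained. -/
lemma exists_optimal_decomposition {d : ℕ} {ρ : Op d d} (hρ : IsState ρ) :
    ∃ (N : ℕ) (φ : Fin N → Fin d × Fin d → ℂ),
      ρ = ∑ k, proj (φ k) ∧ gConcurrence ρ = ∑ k, pureG (φ k) := by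
  have hd := dimension_ne_zero hρ.2
  obtain ⟨φ₀, hφ₀⟩ := exists_unnormalised_decomposition hρ.1
  obtain ⟨r, p, ψ, -, hp, -, -⟩ := exists_isPureDecomposition hρ.2 φ₀ hφ₀
  obtain ⟨φ₁, hφ₁, -⟩ := exists_fixed_length_decomposition hd hp
  obtain ⟨φ, hφ, hmin⟩ := (isCompact_decompositions ρ _).exists_isMinOn ⟨φ₁, hφ₁⟩
    (f := fun φ => ∑ k, pureG (φ k))
    (continuous_finsetSum _ fun k _ => continuous_pureG.comp (continuous_apply k)).continuousOn
  refine ⟨_, φ, hφ, le_antisymm (gConcurrence_le_sum hd hρ.2 φ hφ) ?_⟩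
  refine le_csInf ⟨_, r, p, ψ, hp, rfl⟩ ?_
  rintro _ ⟨r, p, ψ, h, rfl⟩
  obtain ⟨φ', hφ', hval⟩ := exists_fixed_length_decomposition hd h
  rw [hval]
  exact hmin hφ'

/-- A state of vanishing `G`-concurrence is a mixture of pure states with singular coefficient
matrices. -/
lemma exists_singular_decomposition {d : ℕ} {ρ : Op d d} (hρ : IsState ρ)
    (h : gConcurrence ρ = 0) :
    ∃ (r : ℕ) (p : Fin r → ℝ) (ψ : Fin r → Fin d × Fin d → ℂ),
      IsPureDecomposition ρ p ψ ∧ ∀ i, (coeffMatrix (ψ i)).det = 0 := by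
  have hd := dimension_ne_zero hρ.2
  obtain ⟨N, φ, hφ, hG⟩ := exists_optimal_decomposition hρ
  obtain ⟨r, p, ψ, σ, hp, hψ, -⟩ := exists_isPureDecomposition hρ.2 φ hφ
  refine ⟨r, p, ψ, hp, fun i => ?_⟩
  rw [h, eq_comm, Finset.sum_eq_zero_iff_of_nonneg fun k _ => pureG_nonneg _] at hG
  obtain ⟨c, hc⟩ := hψ i
  rw [← pureG_eq_zero_iff hd, hc, pureG_smul hd, hG _ (Finset.mem_univ _), mul_zero]

/-! ### Schmidt number and entanglement -/

lemma rank_lt_iff_det_eq_zero {d : ℕ} (M : Matrix (Fin d) (Fin d) ℂ) :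
    M.rank < d ↔ M.det = 0 := by
  constructor
  · intro h
    by_contra h0
    have := Matrix.rank_of_det_ne_zero h0
    simp only [Fintype.card_fin] at this
    omega
  · intro h
    refine lt_of_le_of_ne (by simpa using M.rank_le_card_width) fun hr => ?_
    have hu : M.mulVecLin.range = ⊤ :=
      Submodule.eq_top_of_finrank_eq (by simpa [Matrix.rank] using hr)
    have hinj := LinearMap.injective_iff_surjective.mpr (LinearMap.range_eq_top.mp hu)
    obtain ⟨v, hv, hMv⟩ := Matrix.exists_mulVec_eq_zero_iff.mpr h
    exact hv (hinj (by simpa using hMv))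

lemma schmidtRank_le {d : ℕ} (ψ : Fin d × Fin d → ℂ) : schmidtRank ψ ≤ d :=
  (coeffMatrix ψ).rank_le_width

lemma schmidtRank_lt_iff {d : ℕ} (ψ : Fin d × Fin d → ℂ) :
    schmidtRank ψ < d ↔ (coeffMatrix ψ).det = 0 :=
  rank_lt_iff_det_eq_zero _

/-- A mixture of pure states with singular coefficient matrices has vanishing `G`-concurrence. -/
lemma gConcurrence_eq_zero_of_singular {d : ℕ} (hd : d ≠ 0) {ρ : Op d d} {r : ℕ} {p : Fin r → ℝ}
    {ψ : Fin r → Fin d × Fin d → ℂ} (h : IsPureDecomposition ρ p ψ)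
    (hψ : ∀ i, (coeffMatrix (ψ i)).det = 0) : gConcurrence ρ = 0 := by
  refine le_antisymm ?_ (gConcurrence_nonneg ρ)
  refine csInf_le (bddBelow_decomposition_values ρ) ⟨r, p, ψ, h, ?_⟩
  exact (Finset.sum_eq_zero fun i _ => by rw [(pureG_eq_zero_iff hd _).mpr (hψ i), mul_zero]).symm

lemma gConcurrence_pos_iff_schmidtNumber {d : ℕ} {ρ : Op d d} (hρ : IsState ρ) :
    0 < gConcurrence ρ ↔ schmidtNumber ρ = d := by
  have hd := dimension_ne_zero hρ.2
  obtain ⟨φ₀, hφ₀⟩ := exists_unnormalised_decomposition hρ.1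
  obtain ⟨r₀, p₀, ψ₀, -, hp₀, -, -⟩ := exists_isPureDecomposition hρ.2 φ₀ hφ₀
  have hmem : ∃ (r : ℕ) (p : Fin r → ℝ) (ψ : Fin r → Fin d × Fin d → ℂ),
      IsPureDecomposition ρ p ψ ∧ ∀ i, schmidtRank (ψ i) ≤ d :=
    ⟨r₀, p₀, ψ₀, hp₀, fun i => schmidtRank_le _⟩
  have hle : schmidtNumber ρ ≤ d := Nat.sInf_le hmem
  constructor
  · intro hpos
    by_contra hne
    obtain ⟨r, p, ψ, hp, hr⟩ := Nat.sInf_mem (s := {k : ℕ | ∃ (r : ℕ) (p : Fin r → ℝ)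
      (ψ : Fin r → Fin d × Fin d → ℂ), IsPureDecomposition ρ p ψ ∧ ∀ i, schmidtRank (ψ i) ≤ k})
      ⟨d, hmem⟩
    refine hpos.ne' (gConcurrence_eq_zero_of_singular hd hp fun i => ?_)
    exact (schmidtRank_lt_iff _).mp ((hr i).trans_lt (lt_of_le_of_ne hle hne))
  · intro hs
    refine lt_of_le_of_ne (gConcurrence_nonneg ρ) fun h0 => ?_
    obtain ⟨r, p, ψ, hp, hdet⟩ := exists_singular_decomposition hρ h0.symm
    have : schmidtNumber ρ ≤ d - 1 := Nat.sInf_le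
      ⟨r, p, ψ, hp, fun i => Nat.le_sub_one_of_lt ((schmidtRank_lt_iff _).mpr (hdet i))⟩
    omega

/-- A singular `2 × 2` matrix has rank at most one. -/
lemma exists_eq_vecMulVec_of_det_eq_zero (M : Matrix (Fin 2) (Fin 2) ℂ) (h : M.det = 0) :
    ∃ u v : Fin 2 → ℂ, M = Matrix.vecMulVec u v := by
  obtain ⟨v, hv, hMv⟩ := Matrix.exists_mulVec_eq_zero_iff.mpr h
  have hrow : ∀ i, M i 0 * v 0 + M i 1 * v 1 = 0 := fun i => by
    simpa [Matrix.mulVec, dotProduct] using congrFun hMv i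
  by_cases h1 : v 1 = 0
  · have h0 : v 0 ≠ 0 := fun h0 => hv (by ext i; fin_cases i <;> simp [h0, h1])
    refine ⟨fun i => M i 1, ![0, 1], ?_⟩
    ext i j
    have := hrow i
    fin_cases j <;> simp_all [Matrix.vecMulVec_apply]
  · refine ⟨fun i => M i 0 / v 1, ![v 1, -v 0], ?_⟩
    ext i j
    have := hrow i
    fin_cases j
    · simp [Matrix.vecMulVec_apply, h1]
    · simp only [Matrix.vecMulVec_apply]
      simp
      field_simp
      linear_combination this

lemma proj_product_apply {a b : ℕ} (u : Fin a → ℂ) (v : Fin b → ℂ) :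
    proj (fun x : Fin a × Fin b => u x.1 * v x.2) =
      Matrix.vecMulVec u (star u) ⊗ₖ Matrix.vecMulVec v (star v) := by
  ext x y
  simp only [proj, Matrix.vecMulVec_apply, Matrix.kroneckerMap_apply, Pi.star_apply, star_mul']
  ring

/-- The normalised rank-one projection onto a nonzero vector. -/
lemma isState_smul_vecMulVec {n : ℕ} {u : Fin n → ℂ} (hu : star u ⬝ᵥ u ≠ 0) :
    IsState ((star u ⬝ᵥ u)⁻¹ • Matrix.vecMulVec u (star u)) := by
  refine ⟨(Matrix.posSemidef_vecMulVec_self_star u).smul ?_, ?_⟩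
  · rw [star_dotProduct_self_eq, ← Complex.ofReal_inv, Complex.zero_le_real]
    exact inv_nonneg.mpr (Finset.sum_nonneg fun x _ => Complex.normSq_nonneg _)
  · rw [Matrix.trace_smul, Matrix.trace_vecMulVec, dotProduct_comm u, smul_eq_mul,
      inv_mul_cancel₀ hu]

lemma not_isSeparableState_iff_gConcurrence_pos {ρ : Op 2 2} (hρ : IsState ρ) :
    ¬ IsSeparableState ρ ↔ 0 < gConcurrence ρ := by
  constructor
  · intro hsep
    refine lt_of_le_of_ne (gConcurrence_nonneg ρ) fun h0 => hsep ?_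
    obtain ⟨r, p, ψ, hp, hdet⟩ := exists_singular_decomposition hρ h0.symm
    choose u v huv using fun i => exists_eq_vecMulVec_of_det_eq_zero _ (hdet i)
    have hψ : ∀ i, ψ i = fun x => u i x.1 * v i x.2 := fun i => by
      funext x
      simpa [coeffMatrix, Matrix.vecMulVec_apply] using congrFun (congrFun (huv i) x.1) x.2
    have hprod : ∀ i, (star (u i) ⬝ᵥ u i) * (star (v i) ⬝ᵥ v i) = 1 := fun i => by
      rw [← hp.2.2.1 i, hψ i]
      simp only [dotProduct, Fintype.sum_prod_type, Finset.sum_mul_sum, Pi.star_apply, star_mul']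
      exact Finset.sum_congr rfl fun _ _ => Finset.sum_congr rfl fun _ _ => by ring
    refine ⟨r, p, _, _, hp.1, hp.2.1,
      fun i => isState_smul_vecMulVec (left_ne_zero_of_mul_eq_one (hprod i)),
      fun i => isState_smul_vecMulVec (right_ne_zero_of_mul_eq_one (hprod i)), ?_⟩
    rw [hp.2.2.2]
    refine Finset.sum_congr rfl fun i _ => ?_
    rw [Matrix.smul_kronecker, Matrix.kronecker_smul, smul_smul (_⁻¹) (_⁻¹), ← mul_inv, hprod, inv_one,
      one_smul, hψ i, proj_product_apply]
  · rintro hpos ⟨r, p, α, β, hp, hp1, hα, hβ, h⟩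
    choose s hs using fun i => exists_eq_sum_vecMulVec (hα i).1
    choose t ht using fun i => exists_eq_sum_vecMulVec (hβ i).1
    -- the unnormalised product vectors which decompose the separable state
    let φ : Fin r × Fin 2 × Fin 2 → Fin 2 × Fin 2 → ℂ := fun k =>
      ((√(p k.1) : ℝ) : ℂ) • fun x => s k.1 k.2.1 x.1 * t k.1 k.2.2 x.2
    have hφ : ρ = ∑ k, proj (φ k) := by
      rw [h, Fintype.sum_prod_type]
      refine Finset.sum_congr rfl fun i _ => ?_
      rw [Fintype.sum_prod_type]
      simp only [φ, proj_smul, Complex.normSq_ofReal, Real.mul_self_sqrt (hp i),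
        proj_product_apply, ← Finset.smul_sum]
      congr 1
      conv_lhs => rw [hs i, ht i]
      ext x y
      simp only [Fin.sum_univ_two, Matrix.add_apply, Matrix.kroneckerMap_apply]
      ring
    refine hpos.not_ge ((gConcurrence_le_sum two_ne_zero hρ.2 φ hφ).trans_eq ?_)
    refine Finset.sum_eq_zero fun k _ => ?_
    rw [pureG_eq_zero_iff two_ne_zero, Matrix.det_fin_two]
    simp only [coeffMatrix, φ, Matrix.of_apply, Pi.smul_apply, smul_eq_mul]
    ring

/-! ### LOCC operations are separable -/

/-- Kraus families of separable operations may be indexed by any finite type. -/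
lemma isSeparableOperation_of_fintype {a b m n : ℕ} {κ : Type*} [Fintype κ]
    {Λ : Op a b → Op m n} (A : κ → Matrix (Fin m) (Fin a) ℂ) (B : κ → Matrix (Fin n) (Fin b) ℂ)
    (h1 : ∑ i, (A i ⊗ₖ B i)ᴴ * (A i ⊗ₖ B i) = 1)
    (h2 : ∀ X, Λ X = ∑ i, (A i ⊗ₖ B i) * X * (A i ⊗ₖ B i)ᴴ) : IsSeparableOperation Λ := by
  let e := (Fintype.equivFin κ).symm
  refine ⟨_, fun i => A (e i), fun i => B (e i), ?_, fun X => ?_⟩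
  · rw [← h1]
    exact e.sum_comp fun i => (A i ⊗ₖ B i)ᴴ * (A i ⊗ₖ B i)
  · rw [h2]
    exact (e.sum_comp fun i => (A i ⊗ₖ B i) * X * (A i ⊗ₖ B i)ᴴ).symm

/-- A product measurement followed by separable operations that depend on the outcome is a
separable operation. -/
lemma isSeparableOperation_measure {a b m n r : ℕ} (c e : Fin r → ℕ)
    (K : (i : Fin r) → Matrix (Fin (c i)) (Fin a) ℂ)
    (L : (i : Fin r) → Matrix (Fin (e i)) (Fin b) ℂ)
    (hKL : ∑ i, (K i ⊗ₖ L i)ᴴ * (K i ⊗ₖ L i) = 1)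
    {Λ : (i : Fin r) → Op (c i) (e i) → Op m n} (hΛ : ∀ i, IsSeparableOperation (Λ i)) :
    IsSeparableOperation fun X : Op a b => ∑ i, Λ i ((K i ⊗ₖ L i) * X * (K i ⊗ₖ L i)ᴴ) := by
  choose s A B h1 h2 using hΛ
  refine isSeparableOperation_of_fintype (κ := (i : Fin r) × Fin (s i))
    (fun k => A k.1 k.2 * K k.1) (fun k => B k.1 k.2 * L k.1) ?_ fun X => ?_
  · rw [← hKL, Fintype.sum_sigma]
    refine Finset.sum_congr rfl fun i _ => ?_
    calc _ = (K i ⊗ₖ L i)ᴴ * (∑ j, (A i j ⊗ₖ B i j)ᴴ * (A i j ⊗ₖ B i j)) * (K i ⊗ₖ L i) := by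
          simp only [Matrix.mul_kronecker_mul, Matrix.conjTranspose_mul, Matrix.mul_sum,
            Matrix.sum_mul, Matrix.mul_assoc]
      _ = _ := by rw [h1, Matrix.mul_one]
  · rw [Fintype.sum_sigma]
    refine Finset.sum_congr rfl fun i _ => ?_
    rw [h2]
    simp only [Matrix.mul_kronecker_mul, Matrix.conjTranspose_mul, Matrix.mul_assoc]

lemma IsLOCC.isSeparableOperation {m n a b : ℕ} {Λ : Op a b → Op m n} (h : IsLOCC m n a b Λ) :
    IsSeparableOperation Λ := by
  induction h with
  | stop_here =>
    exact isSeparableOperation_of_fintype (κ := Unit) (fun _ => 1) (fun _ => 1) (by simp)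
      (by simp)
  | @alice a b r c K hK Λ _ ih =>
    refine isSeparableOperation_measure c (fun _ => b) K (fun _ => 1) ?_ ih
    simp only [Matrix.conjTranspose_kronecker, ← Matrix.mul_kronecker_mul,
      Matrix.conjTranspose_one, Matrix.mul_one]
    rw [← Matrix.one_kronecker_one, ← hK]
    ext x y
    simp [Matrix.sum_apply, Matrix.kroneckerMap_apply, Finset.sum_mul]
  | @bob a b r c K hK Λ _ ih =>
    refine isSeparableOperation_measure (fun _ => a) c (fun _ => 1) K ?_ ih
    simp only [Matrix.conjTranspose_kronecker, ← Matrix.mul_kronecker_mul,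
      Matrix.conjTranspose_one, Matrix.mul_one]
    rw [← Matrix.one_kronecker_one, ← hK]
    ext x y
    simp [Matrix.sum_apply, Matrix.kroneckerMap_apply, Finset.mul_sum]

lemma LOCCSwappable.sepSwappable {d : ℕ} {ρ : Op d d} (h : LOCCSwappable ρ) : SepSwappable ρ :=
  let ⟨Λ, hΛ, hs⟩ := h
  ⟨Λ, hΛ.isSeparableOperation, hs⟩

/-- A product unitary is a protocol of two measurements with a single outcome each. -/
lemma LocalUnitarySwappable.loccSwappable {d : ℕ} {ρ : Op d d} (h : LocalUnitarySwappable ρ) :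
    LOCCSwappable ρ := by
  obtain ⟨UA, hUA, UB, hUB, hs⟩ := h
  refine ⟨_, IsLOCC.alice (r := 1) (fun _ => d) (fun _ => UA)
    (by rw [Fin.sum_univ_one]; exact Matrix.mem_unitaryGroup_iff'.mp hUA) _ fun _ =>
      IsLOCC.bob (r := 1) (fun _ => d) (fun _ => UB)
        (by rw [Fin.sum_univ_one]; exact Matrix.mem_unitaryGroup_iff'.mp hUB) _ fun _ => IsLOCC.stop_here, ?_⟩
  have hU : UA ⊗ₖ UB = (1 ⊗ₖ UB) * (UA ⊗ₖ 1) := by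
    rw [← Matrix.mul_kronecker_mul, Matrix.one_mul, Matrix.mul_one]
  rw [← hs, hU]
  simp only [Fin.sum_univ_one, Matrix.conjTranspose_mul, Matrix.mul_assoc]

/-! ### The swap -/

lemma swapOp_mulVec {d : ℕ} (ψ : Fin d × Fin d → ℂ) : swapOp d *ᵥ ψ = ψ ∘ Prod.swap := by
  funext x
  simp only [swapOp, Matrix.mulVec, dotProduct, Matrix.of_apply, ite_mul, one_mul, zero_mul,
    Function.comp]
  rw [Finset.sum_eq_single x.swap]
  · simp
  · intro y _ hy
    exact if_neg fun h => hy (Prod.ext h.2.symm h.1.symm)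
  · simp

lemma swapOp_conjTranspose (d : ℕ) : (swapOp d)ᴴ = swapOp d := by
  ext x y
  simp only [swapOp, Matrix.conjTranspose_apply, Matrix.of_apply, apply_ite star, star_one,
    star_zero]
  exact if_congr ⟨fun h => ⟨h.2.symm, h.1.symm⟩, fun h => ⟨h.2.symm, h.1.symm⟩⟩ rfl rfl

lemma swapOp_mul_self (d : ℕ) : swapOp d * swapOp d = 1 := by
  refine Matrix.toLin'.injective (LinearMap.ext fun ψ => ?_)
  rw [Matrix.toLin'_apply, ← Matrix.mulVec_mulVec, swapOp_mulVec, swapOp_mulVec, Matrix.toLin'_one]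
  rfl

lemma swapped_apply {d : ℕ} (ρ : Op d d) (x y : Fin d × Fin d) :
    swapped ρ x y = ρ x.swap y.swap := by
  have h : ∀ (X : Op d d) x y, (swapOp d * X) x y = X x.swap y := fun X x y =>
    congrFun (swapOp_mulVec fun z => X z y) x
  rw [swapped, ← Matrix.conjTranspose_conjTranspose (swapOp d * ρ * _),
    Matrix.conjTranspose_mul, Matrix.conjTranspose_conjTranspose, Matrix.conjTranspose_apply, h,
    Matrix.conjTranspose_apply, star_star, h]

lemma swapped_swapped {d : ℕ} (ρ : Op d d) : swapped (swapped ρ) = ρ := by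
  ext x y
  simp [swapped_apply]

lemma isState_swapped {d : ℕ} {ρ : Op d d} (hρ : IsState ρ) : IsState (swapped ρ) := by
  refine ⟨hρ.1.mul_mul_conjTranspose_same _, ?_⟩
  rw [swapped, swapOp_conjTranspose, Matrix.trace_mul_cycle, swapOp_mul_self, Matrix.one_mul, hρ.2]

/-- The coefficient matrix of the swapped vector is the transpose. -/
lemma pureG_swapOp_mulVec {d : ℕ} (ψ : Fin d × Fin d → ℂ) :
    pureG (swapOp d *ᵥ ψ) = pureG ψ := by
  have h : coeffMatrix (swapOp d *ᵥ ψ) = (coeffMatrix ψ)ᵀ := by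
    rw [swapOp_mulVec]
    rfl
  rw [pureG_eq, pureG_eq, h, Matrix.det_transpose]

lemma gConcurrence_le_swapped {d : ℕ} {ρ : Op d d} (hρ : IsState ρ) :
    gConcurrence ρ ≤ gConcurrence (swapped ρ) := by
  obtain ⟨N, φ, hφ, hG⟩ := exists_optimal_decomposition (isState_swapped hρ)
  rw [hG]
  refine (gConcurrence_le_sum (dimension_ne_zero hρ.2) hρ.2 (fun k => swapOp d *ᵥ φ k) ?_).trans_eq
    (Finset.sum_congr rfl fun k _ => pureG_swapOp_mulVec _)
  rw [← swapped_swapped ρ, hφ, swapped, Matrix.mul_sum, Matrix.sum_mul]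
  exact Finset.sum_congr rfl fun k _ => mul_proj_mul_conjTranspose _ _

lemma marginalA_swapped {d : ℕ} (ρ : Op d d) : marginalA (swapped ρ) = marginalB ρ := by
  ext i k
  simp [marginalA, marginalB, swapped_apply]

lemma marginalA_kronecker_conj {d : ℕ} (A : Matrix (Fin d) (Fin d) ℂ) {U : Matrix (Fin d) (Fin d) ℂ}
    (hU : Uᴴ * U = 1) (ρ : Op d d) :
    marginalA ((A ⊗ₖ U) * ρ * (A ⊗ₖ U)ᴴ) = A * marginalA ρ * Aᴴ := by
  have hdec : A ⊗ₖ U = (A ⊗ₖ 1) * (1 ⊗ₖ U) := by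
    rw [← Matrix.mul_kronecker_mul, Matrix.one_mul, Matrix.mul_one]
  have hB : ∀ X : Op d d, marginalA ((1 ⊗ₖ U) * X * (1 ⊗ₖ U)ᴴ) = marginalA X := by
    intro X
    ext i k
    -- the trace over the second factor is cyclic in operators of that factor
    have hblock : marginalA ((1 ⊗ₖ U) * X * (1 ⊗ₖ U)ᴴ) i k =
        (U * (Matrix.of fun j l => X (i, j) (k, l)) * Uᴴ).trace := by
      simp [marginalA, Matrix.trace, Matrix.mul_apply, Fintype.sum_prod_type,
        Matrix.kroneckerMap_apply, Matrix.one_apply, apply_ite star]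
    rw [hblock, Matrix.trace_mul_cycle, hU, Matrix.one_mul]
    rfl
  have hA : ∀ X : Op d d, marginalA ((A ⊗ₖ 1) * X * (A ⊗ₖ 1)ᴴ) = A * marginalA X * Aᴴ := by
    intro X
    ext i k
    simp only [marginalA, Matrix.mul_apply, Fintype.sum_prod_type, Matrix.kroneckerMap_apply,
      Matrix.one_apply, Matrix.conjTranspose_apply, Matrix.of_apply, mul_ite, mul_one, mul_zero,
      ite_mul, zero_mul, Finset.sum_ite_eq, Finset.mem_univ, if_true, apply_ite star, star_zero,
      Finset.sum_mul, Finset.mul_sum]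
    rw [Finset.sum_comm]
    exact Finset.sum_congr rfl fun _ _ => Finset.sum_comm
  have hassoc : (A ⊗ₖ U) * ρ * (A ⊗ₖ U)ᴴ =
      (A ⊗ₖ 1) * ((1 ⊗ₖ U) * ρ * (1 ⊗ₖ U)ᴴ) * (A ⊗ₖ 1)ᴴ := by
    rw [hdec]
    simp only [Matrix.conjTranspose_mul, Matrix.mul_assoc]
  rw [hassoc, hA, hB]

lemma LocalUnitarySwappable.spec_marginal_eq {d : ℕ} {ρ : Op d d} (h : LocalUnitarySwappable ρ) :
    spec (marginalA ρ) = spec (marginalB ρ) := by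
  obtain ⟨UA, hUA, UB, hUB, hs⟩ := h
  have hUA' : UAᴴ * UA = 1 := Matrix.mem_unitaryGroup_iff'.mp hUA
  rw [← marginalA_swapped, ← hs,
    marginalA_kronecker_conj UA (Matrix.mem_unitaryGroup_iff'.mp hUB), spec, spec,
    Matrix.mul_assoc, Matrix.charpoly_mul_comm, Matrix.mul_assoc, hUA', Matrix.mul_one]

/-! ### Equality in the inequality of arithmetic and geometric means -/

/-- For a positive semidefinite matrix the geometric mean of the eigenvalues is at most their
arithmetic mean, with equality only for scalar matrices. -/
lemma det_rpow_le_trace_div_card {ι : Type*} [Fintype ι] [DecidableEq ι] [Nonempty ι]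
    {P : Matrix ι ι ℂ} (hP : P.PosSemidef) :
    P.det.re ^ ((1 : ℝ) / Fintype.card ι) ≤ P.trace.re / Fintype.card ι ∧
    (P.det.re ^ ((1 : ℝ) / Fintype.card ι) = P.trace.re / Fintype.card ι →
      P = ((P.trace.re / Fintype.card ι : ℝ) : ℂ) • 1) := by
  set n := Fintype.card ι with hn
  have hn0 : (0 : ℝ) < n := by exact_mod_cast Fintype.card_pos
  set ev := hP.1.eigenvalues with hev
  have hev0 : ∀ i ∈ Finset.univ, 0 ≤ ev i := fun i _ => hP.eigenvalues_nonneg i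
  have hw : ∀ i ∈ (Finset.univ : Finset ι), (0 : ℝ) < 1 / n := fun _ _ => by positivity
  have hw1 : ∑ _i : ι, (1 : ℝ) / n = 1 := by
    rw [Finset.sum_const, Finset.card_univ, nsmul_eq_mul, mul_one_div_cancel hn0.ne']
  have hdet : P.det.re ^ ((1 : ℝ) / n) = ∏ i, ev i ^ ((1 : ℝ) / n) := by
    have : P.det = ((∏ i, ev i : ℝ) : ℂ) :=
      hP.1.det_eq_prod_eigenvalues.trans (Complex.ofReal_prod _ _).symm
    rw [Real.finsetProd_rpow _ _ hev0, this, Complex.ofReal_re]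
  have htr : P.trace.re / n = ∑ i, (1 : ℝ) / n * ev i := by
    have : P.trace = ((∑ i, ev i : ℝ) : ℂ) :=
      hP.1.trace_eq_sum_eigenvalues.trans (Complex.ofReal_sum _ _).symm
    rw [← Finset.mul_sum, this, Complex.ofReal_re]
    ring
  rw [hdet, htr]
  refine ⟨Real.geom_mean_le_arith_mean_weighted _ _ _ (fun i hi => (hw i hi).le) hw1 hev0,
    fun heq => ?_⟩
  have hconst := (Real.geom_mean_eq_arith_mean_weighted_iff_of_pos' _ _ _ hw hw1 hev0).mp heq
  generalize ∑ i, (1 : ℝ) / n * ev i = t at hconst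
  have hdiag : Matrix.diagonal (RCLike.ofReal ∘ ev : ι → ℂ) = (t : ℂ) • 1 := by
    rw [Matrix.smul_one_eq_diagonal]
    congr 1
    funext i
    simp [hconst i (Finset.mem_univ i)]
  conv_lhs => rw [hP.1.spectral_theorem, ← hev, hdiag, map_smul, map_one]

lemma re_det_kronecker_conjTranspose_mul_self {d : ℕ} (A B : Matrix (Fin d) (Fin d) ℂ) :
    ((A ⊗ₖ B)ᴴ * (A ⊗ₖ B)).det.re = Complex.normSq (A.det * B.det) ^ d := by
  rw [Matrix.det_mul, Matrix.det_conjTranspose, Matrix.det_kronecker, Fintype.card_fin, ← mul_pow,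
    Complex.star_def, ← Complex.normSq_eq_conj_mul_self, Complex.ofReal_re, map_pow]

/-- The factor by which `A ⊗ B` changes the `G`-concurrence is at most the normalised trace of
`(A ⊗ B)† (A ⊗ B)`, with equality only if that operator is scalar. -/
lemma normSq_det_rpow_le {d : ℕ} (hd : d ≠ 0) (A B : Matrix (Fin d) (Fin d) ℂ) :
    Complex.normSq (A.det * B.det) ^ ((1 : ℝ) / d) ≤
      ((A ⊗ₖ B)ᴴ * (A ⊗ₖ B)).trace.re / (d * d) ∧
    (Complex.normSq (A.det * B.det) ^ ((1 : ℝ) / d) =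
        ((A ⊗ₖ B)ᴴ * (A ⊗ₖ B)).trace.re / (d * d) →
      (A ⊗ₖ B)ᴴ * (A ⊗ₖ B) =
        ((((A ⊗ₖ B)ᴴ * (A ⊗ₖ B)).trace.re / (d * d) : ℝ) : ℂ) • 1) := by
  have : Nonempty (Fin d) := ⟨⟨0, Nat.pos_of_ne_zero hd⟩⟩
  have h := det_rpow_le_trace_div_card (Matrix.posSemidef_conjTranspose_mul_self (A ⊗ₖ B))
  have hd' : (d : ℝ) ≠ 0 := Nat.cast_ne_zero.mpr hd
  have hpow : (Complex.normSq (A.det * B.det) ^ d) ^ ((1 : ℝ) / (d * d)) =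
      Complex.normSq (A.det * B.det) ^ ((1 : ℝ) / d) := by
    rw [← Real.rpow_natCast, ← Real.rpow_mul (Complex.normSq_nonneg _)]
    congr 1
    field_simp
  rwa [re_det_kronecker_conjTranspose_mul_self, Fintype.card_prod, Fintype.card_fin, Nat.cast_mul,
    hpow] at h

/-- If `(A ⊗ B)† (A ⊗ B)` is a positive multiple of the identity, then `A` and `B` are multiples
of unitaries. -/
lemma exists_unitary_of_kronecker_scalar {d : ℕ} (hd : d ≠ 0) {A B : Matrix (Fin d) (Fin d) ℂ}
    {t : ℝ} (ht : 0 < t) (h : (A ⊗ₖ B)ᴴ * (A ⊗ₖ B) = (t : ℂ) • 1) :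
    ∃ UA ∈ Matrix.unitaryGroup (Fin d) ℂ, ∃ UB ∈ Matrix.unitaryGroup (Fin d) ℂ,
      A ⊗ₖ B = ((√t : ℝ) : ℂ) • (UA ⊗ₖ UB) := by
  let o : Fin d := ⟨0, Nat.pos_of_ne_zero hd⟩
  have hent : ∀ i k j l, (Aᴴ * A) i k * (Bᴴ * B) j l =
      (t : ℂ) * ((1 : Matrix (Fin d) (Fin d) ℂ) i k * (1 : Matrix (Fin d) (Fin d) ℂ) j l) := by
    intro i k j l
    rw [Matrix.conjTranspose_kronecker, ← Matrix.mul_kronecker_mul,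
      ← Matrix.one_kronecker_one] at h
    exact congrFun (congrFun h (i, j)) (k, l)
  have hdiag : ∀ M : Matrix (Fin d) (Fin d) ℂ, ∃ x : ℝ, 0 ≤ x ∧ (Mᴴ * M) o o = x := fun M =>
    ⟨∑ j, Complex.normSq (M j o), Finset.sum_nonneg fun _ _ => Complex.normSq_nonneg _, by
      simp [Matrix.mul_apply, Complex.normSq_eq_conj_mul_self]⟩
  obtain ⟨x, hx0, hx⟩ := hdiag A
  obtain ⟨y, hy0, hy⟩ := hdiag B
  have hxy : x * y = t := by
    have := hent o o o o
    rw [hx, hy, Matrix.one_apply_eq, mul_one, mul_one] at this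
    exact_mod_cast this
  have hx' : 0 < x := lt_of_le_of_ne hx0 fun h0 => by simp [← h0] at hxy; exact ht.ne hxy
  have hy' : 0 < y := lt_of_le_of_ne hy0 fun h0 => by simp [← h0] at hxy; exact ht.ne hxy
  have hA : Aᴴ * A = (x : ℂ) • 1 := by
    ext i k
    have := hent i k o o
    rw [hy, Matrix.one_apply_eq, mul_one, ← hxy] at this
    rw [Matrix.smul_apply, smul_eq_mul]
    refine mul_right_cancel₀ (b := (y : ℂ)) (by exact_mod_cast hy'.ne') (this.trans ?_)
    push_cast
    ring
  have hB : Bᴴ * B = (y : ℂ) • 1 := by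
    ext j l
    have := hent o o j l
    rw [hx, Matrix.one_apply_eq, one_mul, ← hxy] at this
    rw [Matrix.smul_apply, smul_eq_mul]
    refine mul_left_cancel₀ (a := (x : ℂ)) (by exact_mod_cast hx'.ne') (this.trans ?_)
    push_cast
    ring
  have hunit : ∀ (M : Matrix (Fin d) (Fin d) ℂ) (s : ℝ), 0 < s → Mᴴ * M = (s : ℂ) • 1 →
      (((√s)⁻¹ : ℝ) : ℂ) • M ∈ Matrix.unitaryGroup (Fin d) ℂ := by
    intro M s hs hM
    rw [Matrix.mem_unitaryGroup_iff', Matrix.star_eq_conjTranspose, Matrix.conjTranspose_smul,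
      Matrix.smul_mul, Matrix.mul_smul, hM, smul_smul, smul_smul, Complex.star_def,
      Complex.conj_ofReal, ← Complex.ofReal_mul, ← Complex.ofReal_mul, ← mul_inv,
      Real.mul_self_sqrt hs.le, inv_mul_cancel₀ hs.ne', Complex.ofReal_one, one_smul]
  refine ⟨_, hunit A x hx' hA, _, hunit B y hy' hB, ?_⟩
  rw [Matrix.smul_kronecker, Matrix.kronecker_smul, smul_smul, smul_smul, ← Complex.ofReal_mul,
    ← Complex.ofReal_mul, ← hxy, Real.sqrt_mul hx0, mul_assoc, ← mul_inv,
    mul_inv_cancel₀ (mul_pos (Real.sqrt_pos.mpr hx') (Real.sqrt_pos.mpr hy')).ne',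
    Complex.ofReal_one, one_smul]

/-! ### Swapping by separable operations -/

/-- The equality case of the triangle inequality for the Hilbert–Schmidt norm: if the norm of each
`σ i` is at most `t i` times the norm of the sum `S`, and the weights `t i` add up to one, then
every `σ i` is the multiple `t i • S` of the sum. -/
lemma eq_smul_sum_of_trace_le {ι κ : Type*} [Fintype ι] [Fintype κ] {S : Matrix ι ι ℂ}
    {σ : κ → Matrix ι ι ℂ} {t : κ → ℝ} (ht0 : ∀ i, 0 ≤ t i) (ht : ∑ i, t i = 1)
    (hS : S = ∑ i, σ i)
    (hσ : ∀ i, ((σ i)ᴴ * σ i).trace.re ≤ t i ^ 2 * (Sᴴ * S).trace.re) (i : κ) :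
    σ i = (t i : ℂ) • S := by
  set N := (Sᴴ * S).trace.re with hN
  have hnn : ∀ X : Matrix ι ι ℂ, 0 ≤ (Xᴴ * X).trace.re := fun X =>
    (Complex.nonneg_iff.mp (Matrix.posSemidef_conjTranspose_mul_self X).trace_nonneg).1
  have hz : ∀ X : Matrix ι ι ℂ, (Xᴴ * X).trace.re = 0 → X = 0 := fun X hX => by
    refine Matrix.trace_conjTranspose_mul_self_eq_zero_iff.mp (Complex.ext hX ?_)
    exact (Complex.nonneg_iff.mp (Matrix.posSemidef_conjTranspose_mul_self X).trace_nonneg).2.symm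
  -- the real part of the Hilbert–Schmidt inner product with the sum
  let ip : κ → ℝ := fun i => (Sᴴ * σ i).trace.re
  have hexp : ∀ i, ((σ i - (t i : ℂ) • S)ᴴ * (σ i - (t i : ℂ) • S)).trace.re =
      ((σ i)ᴴ * σ i).trace.re - 2 * t i * ip i + t i ^ 2 * N := by
    intro i
    have hconj : ((σ i)ᴴ * S).trace.re = ip i := by
      have : (σ i)ᴴ * S = (Sᴴ * σ i)ᴴ := by
        rw [Matrix.conjTranspose_mul, Matrix.conjTranspose_conjTranspose]
      rw [this, Matrix.trace_conjTranspose, Complex.star_def, Complex.conj_re]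
    rw [Matrix.conjTranspose_sub, Matrix.conjTranspose_smul, Complex.star_def, Complex.conj_ofReal]
    simp only [Matrix.sub_mul, Matrix.mul_sub, Matrix.smul_mul, Matrix.mul_smul,
      Matrix.trace_sub, Matrix.trace_smul, smul_eq_mul, Complex.sub_re, Complex.re_ofReal_mul,
      hconj, hN, ip]
    ring
  have hle : ∀ i, ip i ≤ t i * N := by
    intro i
    rcases (ht0 i).eq_or_lt with h0 | hpos
    · have : σ i = 0 := hz _ (le_antisymm (by simpa [← h0] using hσ i) (hnn _))
      simp [ip, this, ← h0]
    · have := hexp i ▸ hnn (σ i - (t i : ℂ) • S)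
      have h2 : 0 ≤ t i * (t i * N - ip i) := by nlinarith [hσ i]
      linarith [nonneg_of_mul_nonneg_right h2 hpos]
  have hsum : ∑ i, ip i = ∑ i, t i * N := by
    rw [← Finset.sum_mul, ht, one_mul, ← Complex.re_sum, ← Matrix.trace_sum, ← Matrix.mul_sum,
      ← hS]
  have heq := (Finset.sum_eq_sum_iff_of_le fun i _ => hle i).mp hsum i (Finset.mem_univ i)
  refine sub_eq_zero.mp (hz _ (le_antisymm ?_ (hnn _)))
  rw [hexp, heq]
  nlinarith [hσ i]

/-- A separable operation that does not decrease a positive `G`-concurrence is a mixture of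
product unitaries, and if a mixture of unitaries preserves the purity of `ρ`, then each of them
maps `ρ` to the same state. -/
lemma SepSwappable.localUnitarySwappable {d : ℕ} {ρ : Op d d} (hρ : IsState ρ)
    (hG : 0 < gConcurrence ρ) (h : SepSwappable ρ) : LocalUnitarySwappable ρ := by
  have hd := dimension_ne_zero hρ.2
  have hdd : (d : ℝ) * d ≠ 0 := by simp [hd]
  obtain ⟨Λ, ⟨r, A, B, h1, h2⟩, hs⟩ := h
  rw [h2] at hs
  set C : Fin r → Op d d := fun i => A i ⊗ₖ B i with hC
  set g : Fin r → ℝ := fun i => Complex.normSq ((A i).det * (B i).det) ^ ((1 : ℝ) / d) with hg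
  set t : Fin r → ℝ := fun i => ((C i)ᴴ * C i).trace.re / (d * d) with ht
  have hgt : ∀ i, g i ≤ t i := fun i => (normSq_det_rpow_le hd (A i) (B i)).1
  have ht1 : ∑ i, t i = 1 := by
    rw [ht, ← Finset.sum_div, ← Complex.re_sum, ← Matrix.trace_sum, h1, Matrix.trace_one]
    simp [hd]
  have hg1 : 1 ≤ ∑ i, g i := by
    obtain ⟨N, φ, hφ, hGφ⟩ := exists_optimal_decomposition hρ
    have hdec : swapped ρ = ∑ k : Fin r × Fin N, proj (C k.1 *ᵥ φ k.2) := by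
      rw [← hs, Fintype.sum_prod_type]
      refine Finset.sum_congr rfl fun i _ => ?_
      conv_lhs => rw [hφ, Matrix.mul_sum, Matrix.sum_mul]
      exact Finset.sum_congr rfl fun k _ => mul_proj_mul_conjTranspose _ _
    have hle := (gConcurrence_le_swapped hρ).trans
      (gConcurrence_le_sum hd (isState_swapped hρ).2 _ hdec)
    rw [Fintype.sum_prod_type] at hle
    simp only [hC, pureG_kronecker_mulVec, ← Finset.mul_sum, ← hGφ] at hle
    rw [← Finset.sum_mul] at hle
    exact le_of_mul_le_mul_right ((one_mul _).trans_le hle) hG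
  have hsum : ∑ i, g i = ∑ i, t i :=
    le_antisymm (Finset.sum_le_sum fun i _ => hgt i) (ht1.trans_le hg1)
  have hscal : ∀ i, (C i)ᴴ * C i = (t i : ℂ) • 1 := fun i =>
    (normSq_det_rpow_le hd (A i) (B i)).2
      ((Finset.sum_eq_sum_iff_of_le fun i _ => hgt i).mp hsum i (Finset.mem_univ i))
  have ht0 : ∀ i, 0 ≤ t i := fun i =>
    (Real.rpow_nonneg (Complex.normSq_nonneg _) _).trans (hgt i)
  have hpur : ∀ (X : Op d d) (s : ℝ), Xᴴ * X = (s : ℂ) • 1 →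
      ((X * ρ * Xᴴ)ᴴ * (X * ρ * Xᴴ)).trace.re = s ^ 2 * (ρᴴ * ρ).trace.re := by
    intro X s hX
    have : (X * ρ * Xᴴ)ᴴ * (X * ρ * Xᴴ) = X * (ρᴴ * (Xᴴ * X) * ρ) * Xᴴ := by
      simp only [Matrix.conjTranspose_mul, Matrix.conjTranspose_conjTranspose, Matrix.mul_assoc]
    rw [this, Matrix.trace_mul_cycle, hX]
    simp only [Matrix.smul_mul, Matrix.mul_smul, Matrix.one_mul, Matrix.mul_one,
      Matrix.trace_smul, smul_eq_mul, Complex.re_ofReal_mul]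
    ring
  have hpurS : ((swapped ρ)ᴴ * swapped ρ).trace.re = (ρᴴ * ρ).trace.re := by
    rw [swapped, hpur _ 1 (by rw [swapOp_conjTranspose, swapOp_mul_self]; simp)]
    ring
  have hterm := eq_smul_sum_of_trace_le (S := swapped ρ) (σ := fun i => C i * ρ * (C i)ᴴ) ht0 ht1
    hs.symm fun i => by rw [hpur _ _ (hscal i), hpurS]
  obtain ⟨i, -, hi⟩ : ∃ i ∈ Finset.univ, 0 < t i :=
    Finset.exists_lt_of_sum_lt (by simpa using ht1.symm ▸ one_pos)
  obtain ⟨UA, hUA, UB, hUB, hU⟩ := exists_unitary_of_kronecker_scalar hd hi (hscal i)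
  refine ⟨UA, hUA, UB, hUB, ?_⟩
  have hi' : (t i : ℂ) ≠ 0 := by exact_mod_cast hi.ne'
  refine smul_right_injective _ hi' ?_
  have := hterm i
  simp only [hC, hU, Matrix.conjTranspose_smul, Matrix.smul_mul, Matrix.mul_smul, smul_smul,
    Complex.star_def, Complex.conj_ofReal, ← Complex.ofReal_mul, Real.mul_self_sqrt hi.le] at this
  exact this

end Bipartite

open Bipartite
theorem theorem1 (d : ℕ) (ρ : Matrix (Fin d × Fin d) (Fin d × Fin d) ℂ) (hρ : IsState ρ) :
    (0 < gConcurrence ρ ↔ schmidtNumber ρ = d) ∧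
    (0 < gConcurrence ρ → LOCCSwappable ρ → LocalUnitarySwappable ρ) ∧
    (0 < gConcurrence ρ → SepSwappable ρ → LocalUnitarySwappable ρ) ∧
    (0 < gConcurrence ρ → spec (marginalA ρ) ≠ spec (marginalB ρ) →
      ¬ LOCCSwappable ρ ∧ ¬ SepSwappable ρ) ∧
    (d = 2 →
      (IsEntangled ρ ↔ 0 < gConcurrence ρ) ∧
      (IsEntangled ρ → (LOCCSwappable ρ ↔ LocalUnitarySwappable ρ)) ∧
      (IsEntangled ρ → (SepSwappable ρ ↔ LocalUnitarySwappable ρ))) := by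
  refine ⟨gConcurrence_pos_iff_schmidtNumber hρ,
    fun hG h => h.sepSwappable.localUnitarySwappable hρ hG,
    fun hG h => h.localUnitarySwappable hρ hG, fun hG hne => ?_, ?_⟩
  · have : ¬ SepSwappable ρ := fun h => hne (h.localUnitarySwappable hρ hG).spec_marginal_eq
    exact ⟨fun h => this h.sepSwappable, this⟩
  · rintro rfl
    have hent : IsEntangled ρ ↔ 0 < gConcurrence ρ :=
      (and_iff_right hρ).trans (not_isSeparableState_iff_gConcurrence_pos hρ)
    refine ⟨hent, fun h => ⟨fun hs => ?_, fun hs => hs.loccSwappable⟩,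
      fun h => ⟨fun hs => ?_, fun hs => hs.loccSwappable.sepSwappable⟩⟩
    · exact hs.sepSwappable.localUnitarySwappable hρ (hent.mp h)
    · exact hs.localUnitarySwappable hρ (hent.mp h)
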